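/- Let $\Omega$ be a set (possibly infinite) and let $\underline P:2^\Omega\to\mathbb R$ be a coherent lower probability that is $2$-monotone, i.e. $\underline P(A\cup C)+\underline P(A\cap C)\ge \underline P(A)+\underline P(C)$ for all $A,C\subseteq\Omega$. Let $\overline P(A)=1-\underline P(A^c)$ be its conjugate and let $\emptyset\ne B\subseteq\Omega$. Here a lower probability $\underline Q$ on a set $\mathcal D$ of conditional events $A|C$ ($C\neq\emptyset$; an event $A$ is identified with $A|\Omega$) is coherent (in Williams' sense) if for all $m\ge 0$, all $A_0|C_0,\dots,A_m|C_m\in\mathcal D$ and all reals $s_0,\dots,s_m\ge 0$ such that $S=\bigcup\{C_i: s_i\ne0\}$ is non-empty, $$\sup_{\omega\in S}\Big(\sum_{i=1}^m s_i 1_{C_i}(\omega)\big(1_{A_i}(\omega)-\underline Q(A_i|C_i)\big)-s_0 1_{C_0}(\omega)\big(1_{A_0}(\omega)-\underline Q(A_0|C_0)\big)\Big)\ge 0 .$$ A function $p$ on $\mathcal D$ is a (precise) probability if it is coherent in the sense of de Finetti: $\sup_{\omega\in S}\sum_{i=1}^m s_i1_{C_i}(\omega)(1_{A_i}(\omega)-p(A_i|C_i))\ge0$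 for all $m$, all $A_1|C_1,\dots,A_m|C_m\in\mathcal D$ and all reals $s_1,\dots,s_m$ of any sign such that $S=\bigcup\{C_i: s_i\ne0\}$ is non-empty. Put $\mathcal D_B=\{A, A|B : A\subseteq\Omega\}$. The natural extension $\underline E$ of $\underline P$ is the pointwise least coherent lower probability on $\mathcal D_B$ that extends $\underline P$. Let $\mathcal M^+$ be the set of probabilities $p\ge\underline P$ on $2^\Omega$ with $p(B)>0$. The regular extension $\underline R$ is, on $\mathcal D_B$, the pointwise infimum of all probabilities on $\mathcal D_B$ whose restriction to $2^\Omega$ belongs to $\mathcal M^+$ if $\mathcal M^+\ne\emptyset$, and $\underline R=\underline E$ if $\mathcal M^+=\emptyset$. Then $\underline E$ exists, and for every $A\subseteq\Omega$ we have $\underline R(A|B)\ne\underline E(A|B)$ if and only if $$0=\underline P(B)<\overline P(B),\qquad A^c\cap B\neq\emptyset\qquad\text{and}\qquad \overline P(A^c\cap B)=0 .$$ In this case $\underline R(A|B)=1>0=\underline E(A|B)$. -/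

import Mathlib

open Set

noncomputable section

namespace ImpreciseProb

/-- A conditional event `A|B` with `B ≠ ∅`. The points of `Ω` are the elements of the partition, and
events are arbitrary subsets of `Ω`. -/
structure CondEvent (Ω : Type*) where
  event : Set Ω
  given : Set Ω
  given_nonempty : given.Nonempty

variable {Ω : Type*}

/-- The elementary gain `1_B (1_A - x)` from a unit bet on `A|B` at price `x`. -/
def gain (E : CondEvent Ω) (x : ℝ) (ω : Ω) : ℝ :=
  E.given.indicator (fun ω' => E.event.indicator (fun _ => (1 : ℝ)) ω' - x) ω

/-- Williams coherence of a lower probability `Q` on an arbitrary set `D` of conditional events: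
for all `E₀, E₁, …, Eₘ ∈ D` and all stakes `s₀, …, sₘ ≥ 0`, with `G` the gain from betting in favour
of `E₁, …, Eₘ` and against `E₀`, and `S` the union of the conditioning events of the bets with
non-zero stake, `sup (G | S) ≥ 0` whenever `S ≠ ∅`. (`G` is a bounded function.) -/
def WCoherent {D : Set (CondEvent Ω)} (Q : D → ℝ) : Prop :=
  ∀ (m : ℕ) (E₀ : D) (E : Fin m → D) (s₀ : ℝ) (s : Fin m → ℝ), 0 ≤ s₀ → (∀ i, 0 ≤ s i) →
    ∀ S : Set Ω, S = {ω | (s₀ ≠ 0 ∧ ω ∈ E₀.1.given) ∨ ∃ i, s i ≠ 0 ∧ ω ∈ (E i).1.given} →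
      S.Nonempty →
      0 ≤ sSup ((fun ω => ∑ i, s i * gain (E i).1 (Q (E i)) ω - s₀ * gain E₀.1 (Q E₀) ω) '' S)

/-- A (precise) probability on an arbitrary set `D` of conditional events, that is, coherent in the
sense of de Finetti: as above, with stakes of any sign. -/
def DFCoherent {D : Set (CondEvent Ω)} (Q : D → ℝ) : Prop :=
  ∀ (m : ℕ) (E : Fin m → D) (s : Fin m → ℝ),
    ∀ S : Set Ω, S = {ω | ∃ i, s i ≠ 0 ∧ ω ∈ (E i).1.given} → S.Nonempty →
      0 ≤ sSup ((fun ω => ∑ i, s i * gain (E i).1 (Q (E i)) ω) '' S)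

/-- The unconditional events, `A` being identified with `A|Ω`. -/
def uncondEvents (Ω : Type*) : Set (CondEvent Ω) := {E | E.given = univ}

/-- A function of events, seen as a function on the conditional events `A|Ω`. -/
def onUncond (P : Set Ω → ℝ) : uncondEvents Ω → ℝ := fun E => P E.1.event

/-- Coherence of an unconditional lower probability on the power set. -/
def CoherentLower (P : Set Ω → ℝ) : Prop := WCoherent (onUncond P)

/-- `2`-monotonicity. -/
def TwoMonotone (P : Set Ω → ℝ) : Prop := ∀ A B : Set Ω, P A + P B ≤ P (A ∪ B) + P (A ∩ B)

/-- The conjugate upper probability. -/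
def conj (P : Set Ω → ℝ) (A : Set Ω) : ℝ := 1 - P Aᶜ

/-- The credal set: all (precise) probabilities on the power set that dominate `P`. -/
def credal (P : Set Ω → ℝ) : Set (Set Ω → ℝ) := {p | DFCoherent (onUncond p) ∧ ∀ A, P A ≤ p A}

/-- The members of the credal set that give `B` positive probability. -/
def credalPos (P : Set Ω → ℝ) (B : Set Ω) : Set (Set Ω → ℝ) := {p | p ∈ credal P ∧ 0 < p B}

/-- The domain consisting of all events `A` (that is, `A|Ω`) and all conditional events `A|B`. -/
def extDomain (B : Set Ω) : Set (CondEvent Ω) := {E | E.given = univ ∨ E.given = B}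

/-- `A|B` as a member of the extended domain. -/
def condOn (A : Set Ω) {B : Set Ω} (hB : B.Nonempty) : extDomain B := ⟨⟨A, B, hB⟩, Or.inr rfl⟩

/-- The unconditional event `A` as a member of the extended domain. -/
def uncond (A : Set Ω) {B : Set Ω} (hB : B.Nonempty) : extDomain B :=
  ⟨⟨A, univ, hB.mono (subset_univ B)⟩, Or.inl rfl⟩

/-- The restriction to unconditional events of a function on the extended domain. -/
def restrictUncond {B : Set Ω} (hB : B.Nonempty) (Q : extDomain B → ℝ) : Set Ω → ℝ :=
  fun A => Q (uncond A hB)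

/-- The Williams coherent extensions of `P` to the events and the conditional events `A|B`. -/
def coherentExtensions (P : Set Ω → ℝ) {B : Set Ω} (hB : B.Nonempty) : Set (extDomain B → ℝ) :=
  {Q | WCoherent Q ∧ restrictUncond hB Q = P}

/-- The natural extension, i.e. the least coherent extension, written as the pointwise infimum of
all coherent extensions. -/
def natExt (P : Set Ω → ℝ) {B : Set Ω} (hB : B.Nonempty) : extDomain B → ℝ :=
  fun E => sInf ((fun Q : extDomain B → ℝ => Q E) '' coherentExtensions P hB)

/-- The (precise) probabilities on the extended domain that extend a member of `credalPos P B`. -/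
def credalPosExt (P : Set Ω → ℝ) {B : Set Ω} (hB : B.Nonempty) : Set (extDomain B → ℝ) :=
  {p | DFCoherent p ∧ restrictUncond hB p ∈ credalPos P B}

open Classical in
/-- The regular extension: the lower envelope of `credalPosExt P hB` if some member of the credal
set gives `B` positive probability, and the natural extension otherwise. -/
def regExt (P : Set Ω → ℝ) {B : Set Ω} (hB : B.Nonempty) : extDomain B → ℝ :=
  if (credalPos P B).Nonempty then
    fun E => sInf ((fun p : extDomain B → ℝ => p E) '' credalPosExt P hB)
  else natExt P hB

end ImpreciseProb

end

namespace ImpreciseProb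

variable {Ω : Type*}

/-! ### Suprema of gains -/

lemma nonneg_sSup_image {G : Ω → ℝ} {S : Set Ω} (h : ∀ c, (∀ ω ∈ S, G ω ≤ c) → 0 ≤ c) :
    0 ≤ sSup (G '' S) := by
  by_cases hb : BddAbove (G '' S)
  · exact h _ fun ω hω => le_csSup hb (mem_image_of_mem _ hω)
  · rw [Real.sSup_of_not_bddAbove hb]

lemma nonneg_of_nonneg_sSup_image {G : Ω → ℝ} {S : Set Ω} (hS : S.Nonempty)
    (h : 0 ≤ sSup (G '' S)) {c : ℝ} (hc : ∀ ω ∈ S, G ω ≤ c) : 0 ≤ c :=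
  h.trans (csSup_le (hS.image _) (by rintro _ ⟨ω, hω, rfl⟩; exact hc ω hω))

lemma gain_of_notMem {E : CondEvent Ω} {x : ℝ} {ω : Ω} (h : ω ∉ E.given) : gain E x ω = 0 :=
  indicator_of_notMem h _

lemma gain_anti (E : CondEvent Ω) {x y : ℝ} (h : x ≤ y) (ω : Ω) : gain E y ω ≤ gain E x ω := by
  by_cases hω : ω ∈ E.given
  · simp only [gain, indicator_of_mem hω]; linarith
  · rw [gain_of_notMem hω, gain_of_notMem hω]

lemma gain_le_add (E : CondEvent Ω) {x y ε : ℝ} (hε : 0 ≤ ε) (h : y ≤ x + ε) (ω : Ω) :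
    gain E x ω ≤ gain E y ω + ε := by
  by_cases hω : ω ∈ E.given
  · simp only [gain, indicator_of_mem hω]; linarith
  · rw [gain_of_notMem hω, gain_of_notMem hω]; linarith

lemma gain_eq_sub (E : CondEvent Ω) (x : ℝ) (ω : Ω) :
    gain E x ω = (E.event ∩ E.given).indicator (fun _ => (1 : ℝ)) ω -
      x * E.given.indicator (fun _ => (1 : ℝ)) ω := by
  by_cases hC : ω ∈ E.given <;> by_cases hA : ω ∈ E.event <;> simp [gain, hC, hA]

section Coherence

variable {D : Set (CondEvent Ω)} {Q : D → ℝ}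

lemma WCoherent.nonneg_of_le (hQ : WCoherent Q) {m : ℕ} (E₀ : D) (E : Fin m → D) {s₀ : ℝ}
    {s : Fin m → ℝ} (hs₀ : 0 ≤ s₀) (hs : ∀ i, 0 ≤ s i) {c : ℝ}
    (hne : ∃ ω, (s₀ ≠ 0 ∧ ω ∈ E₀.1.given) ∨ ∃ i, s i ≠ 0 ∧ ω ∈ (E i).1.given)
    (hc : ∀ ω, ((s₀ ≠ 0 ∧ ω ∈ E₀.1.given) ∨ ∃ i, s i ≠ 0 ∧ ω ∈ (E i).1.given) →
      ∑ i, s i * gain (E i).1 (Q (E i)) ω - s₀ * gain E₀.1 (Q E₀) ω ≤ c) : 0 ≤ c :=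
  nonneg_of_nonneg_sSup_image hne (hQ m E₀ E s₀ s hs₀ hs _ rfl hne) hc

lemma WCoherent.nonneg (hQ : WCoherent Q) (E : D) : 0 ≤ Q E := by
  refine hQ.nonneg_of_le (m := 0) E Fin.elim0 (s₀ := 1) (s := Fin.elim0) zero_le_one
    (fun i => i.elim0) ⟨_, Or.inl ⟨one_ne_zero, E.1.given_nonempty.some_mem⟩⟩ fun ω hω => ?_
  obtain ⟨-, hω⟩ | ⟨i, -⟩ := hω
  · by_cases hA : ω ∈ E.1.event <;> simp [gain, hω, hA]
  · exact i.elim0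

lemma WCoherent.one_le (hQ : WCoherent Q) (E : D) (h : E.1.given ⊆ E.1.event) : 1 ≤ Q E := by
  have : 0 ≤ Q E - 1 := by
    refine hQ.nonneg_of_le (m := 0) E Fin.elim0 (s₀ := 1) (s := Fin.elim0) zero_le_one
      (fun i => i.elim0) ⟨_, Or.inl ⟨one_ne_zero, E.1.given_nonempty.some_mem⟩⟩ fun ω hω => ?_
    obtain ⟨-, hω⟩ | ⟨i, -⟩ := hω
    · simp [gain, hω, h hω]
    · exact i.elim0
  linarith

lemma WCoherent.le_of_subset (hQ : WCoherent Q) (E F : D) (hEF : E.1.given = F.1.given)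
    (h : E.1.event ⊆ F.1.event) : Q E ≤ Q F := by
  have : 0 ≤ Q F - Q E := by
    refine hQ.nonneg_of_le (m := 1) F (fun _ => E) (s₀ := 1) (s := fun _ => 1) zero_le_one
      (fun i => zero_le_one) ⟨_, Or.inl ⟨one_ne_zero, F.1.given_nonempty.some_mem⟩⟩ fun ω hω => ?_
    have hω : ω ∈ F.1.given := by
      obtain ⟨-, hω⟩ | ⟨i, -, hω⟩ := hω
      exacts [hω, hEF ▸ hω]
    by_cases hE : ω ∈ E.1.event
    · simp [gain, hEF, hω, hE, h hE]
    · by_cases hF : ω ∈ F.1.event <;> simp [gain, hEF, hω, hE, hF]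
  linarith

lemma WCoherent.le_one (hQ : WCoherent Q) (E : D) : Q E ≤ 1 := by
  have : 0 ≤ 1 - Q E := by
    refine hQ.nonneg_of_le (m := 1) E (fun _ => E) (s₀ := 0) (s := fun _ => 1) le_rfl
      (fun i => zero_le_one) ⟨_, Or.inr ⟨0, one_ne_zero, E.1.given_nonempty.some_mem⟩⟩
      fun ω hω => ?_
    have hω : ω ∈ E.1.given := by
      obtain ⟨h, -⟩ | ⟨i, -, hω⟩ := hω
      exacts [absurd rfl h, hω]
    by_cases hE : ω ∈ E.1.event <;> simp [gain, hω, hE]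
  linarith

lemma WCoherent.le_zero (hQ : WCoherent Q) (E : D) (h : E.1.event = ∅) : Q E ≤ 0 := by
  have : 0 ≤ - Q E := by
    refine hQ.nonneg_of_le (m := 1) E (fun _ => E) (s₀ := 0) (s := fun _ => 1) le_rfl
      (fun i => zero_le_one) ⟨_, Or.inr ⟨0, one_ne_zero, E.1.given_nonempty.some_mem⟩⟩
      fun ω hω => ?_
    have hω : ω ∈ E.1.given := by
      obtain ⟨h, -⟩ | ⟨i, -, hω⟩ := hω
      exacts [absurd rfl h, hω]
    simp [gain, hω, h]
  linarith

lemma DFCoherent.wCoherent (hQ : DFCoherent Q) : WCoherent Q := by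
  intro m E₀ E s₀ s _ _ S hS hne
  have := hQ (m + 1) (Fin.cons E₀ E) (Fin.cons (-s₀) s) S (by
    rw [hS]; ext ω; simp [Fin.exists_fin_succ]) hne
  simp only [Fin.sum_univ_succ, Fin.cons_zero, Fin.cons_succ] at this
  convert this using 4
  ring

/-- A combination of bets with a constant gain has gain zero. -/
lemma DFCoherent.eq_zero_of_const (hQ : DFCoherent Q) {m : ℕ} (E : Fin m → D) (s : Fin m → ℝ)
    {c : ℝ} (hs : ∃ i, s i ≠ 0) (hc : ∀ ω, ∑ i, s i * gain (E i).1 (Q (E i)) ω = c) : c = 0 := by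
  obtain ⟨i, hi⟩ := hs
  obtain ⟨ω, hω⟩ := (E i).1.given_nonempty
  have hne : {ω | ∃ i, s i ≠ 0 ∧ ω ∈ (E i).1.given}.Nonempty := ⟨ω, i, hi, hω⟩
  have h₁ := nonneg_of_nonneg_sSup_image hne (hQ m E s _ rfl hne) (c := c) fun ω _ => (hc ω).le
  have h₂ := nonneg_of_nonneg_sSup_image hne
    (hQ m E (fun i => - s i) _ (by simp only [ne_eq, neg_eq_zero]) hne) (c := -c)
    fun ω _ => by simp [← hc ω]
  linarith

/-- Coherence is preserved under lower envelopes. -/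
lemma WCoherent.sInf_image {F : Set (D → ℝ)} (hF : ∀ Q ∈ F, WCoherent Q) (hne : F.Nonempty) :
    WCoherent fun E => sInf ((fun Q : D → ℝ => Q E) '' F) := by
  rintro m E₀ E s₀ s hs₀ hs S rfl hSne
  refine nonneg_sSup_image fun c hc => ?_
  have hle : ∀ Q ∈ F, ∀ E, sInf ((fun Q : D → ℝ => Q E) '' F) ≤ Q E := fun Q hQ E =>
    csInf_le ⟨0, by rintro _ ⟨Q, hQ, rfl⟩; exact (hF Q hQ).nonneg E⟩ (mem_image_of_mem _ hQ)
  have key : ∀ ε > 0, 0 ≤ c + s₀ * ε := by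
    intro ε hε
    obtain ⟨_, ⟨Q, hQ, rfl⟩, hlt⟩ := exists_lt_of_csInf_lt
      (hne.image fun Q : D → ℝ => Q E₀) (lt_add_of_pos_right _ hε)
    refine (hF Q hQ).nonneg_of_le E₀ E hs₀ hs hSne fun ω hω => ?_
    have h₁ := hc ω hω
    have h₂ : ∑ i, s i * gain (E i).1 (Q (E i)) ω ≤
        ∑ i, s i * gain (E i).1 (sInf ((fun Q : D → ℝ => Q (E i)) '' F)) ω :=
      Finset.sum_le_sum fun i _ =>
        mul_le_mul_of_nonneg_left (gain_anti _ (hle Q hQ _) ω) (hs i)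
    have h₃ := mul_le_mul_of_nonneg_left (gain_le_add E₀.1 hε.le hlt.le ω) hs₀
    simp only at h₁
    linarith
  by_contra! hlt
  have := key (-c / (2 * (s₀ + 1))) (by apply div_pos <;> linarith)
  have h₄ : s₀ * (-c / (2 * (s₀ + 1))) ≤ -c / 2 := by
    rw [← mul_div_assoc, div_le_div_iff₀ (by linarith) (by norm_num)]
    nlinarith
  linarith

end Coherence

/-! ### Finitely additive probabilities -/

/-- A finitely additive probability on the power set. -/
structure IsFinAddProb (p : Set Ω → ℝ) : Prop where
  nonneg : ∀ A, 0 ≤ p A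
  apply_univ : p univ = 1
  union : ∀ A C, Disjoint A C → p (A ∪ C) = p A + p C

namespace IsFinAddProb

variable {p : Set Ω → ℝ}

lemma apply_empty (hp : IsFinAddProb p) : p ∅ = 0 := by
  have := hp.union ∅ ∅ (disjoint_empty _)
  simp only [union_empty] at this
  linarith

lemma mono (hp : IsFinAddProb p) {A C : Set Ω} (h : A ⊆ C) : p A ≤ p C := by
  rw [← union_sdiff_cancel h, hp.union _ _ disjoint_sdiff_right]
  linarith [hp.nonneg (C \ A)]

lemma compl (hp : IsFinAddProb p) (A : Set Ω) : p Aᶜ = 1 - p A := by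
  rw [← hp.apply_univ, ← union_compl_self A, hp.union _ _ disjoint_compl_right]
  ring

lemma inter_add_compl_inter (hp : IsFinAddProb p) (A B : Set Ω) :
    p (A ∩ B) + p (Aᶜ ∩ B) = p B := by
  rw [← hp.union _ _ (disjoint_compl_right.mono inter_subset_left inter_subset_left),
    ← union_inter_distrib_right, union_compl_self, univ_inter]

lemma preimage_finset (hp : IsFinAddProb p) {κ : Type*} [DecidableEq κ] (φ : Ω → κ)
    (T : Finset κ) : p (φ ⁻¹' T) = ∑ J ∈ T, p (φ ⁻¹' {J}) := by
  induction T using Finset.induction_on with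
  | empty => simp [hp.apply_empty]
  | insert J T hJ ih =>
    rw [Finset.sum_insert hJ, ← ih, Finset.coe_insert, insert_eq, preimage_union, hp.union]
    exact Disjoint.preimage φ (by simpa using hJ)

/-- Positivity of the expectation of simple functions. -/
lemma sum_nonpos (hp : IsFinAddProb p) {ι : Type*} [Fintype ι] (a : ι → ℝ) (A : ι → Set Ω)
    (h : ∀ ω, ∑ i, a i * (A i).indicator (fun _ => (1 : ℝ)) ω ≤ 0) :
    ∑ i, a i * p (A i) ≤ 0 := by
  classical
  let φ : Ω → Finset ι := fun ω => Finset.univ.filter fun i => ω ∈ A i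
  have hA : ∀ i, p (A i) = ∑ J : Finset ι, if i ∈ J then p (φ ⁻¹' {J}) else 0 := by
    intro i
    rw [← Finset.sum_filter, ← hp.preimage_finset φ]
    congr 1
    ext ω
    simp [φ]
  simp only [hA, Finset.mul_sum]
  rw [Finset.sum_comm]
  refine Finset.sum_nonpos fun J _ => ?_
  have hJ : ∑ i, a i * (if i ∈ J then p (φ ⁻¹' {J}) else 0) =
      (∑ i, a i * if i ∈ J then 1 else 0) * p (φ ⁻¹' {J}) := by
    rw [Finset.sum_mul]
    refine Finset.sum_congr rfl fun i _ => ?_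
    split_ifs <;> ring
  rw [hJ]
  rcases (φ ⁻¹' {J}).eq_empty_or_nonempty with he | ⟨ω, hω⟩
  · simp [he, hp.apply_empty]
  · refine mul_nonpos_of_nonpos_of_nonneg ?_ (hp.nonneg _)
    have hω : φ ω = J := hω
    refine le_trans (le_of_eq (Finset.sum_congr rfl fun i _ => ?_)) (h ω)
    simp [← hω, φ, indicator_apply]

/-- The expectation of a gain that is bounded on the support of the bets. -/
lemma sum_le_of_gain_le (hp : IsFinAddProb p) {m : ℕ} (E : Fin m → CondEvent Ω)
    (s x : Fin m → ℝ) {c : ℝ} {S : Set Ω} (hS : S = {ω | ∃ i, s i ≠ 0 ∧ ω ∈ (E i).given})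
    (hc : ∀ ω ∈ S, ∑ i, s i * gain (E i) (x i) ω ≤ c) :
    ∑ i, s i * (p ((E i).event ∩ (E i).given) - x i * p (E i).given) ≤ c * p S := by
  let a : Option (Fin m ⊕ Fin m) → ℝ := fun o =>
    o.elim (-c) (Sum.elim s fun i => -(s i * x i))
  let A : Option (Fin m ⊕ Fin m) → Set Ω := fun o =>
    o.elim S (Sum.elim (fun i => (E i).event ∩ (E i).given) fun i => (E i).given)
  have := hp.sum_nonpos a A <| by
    intro ω
    simp only [a, A, Fintype.sum_option, Fintype.sum_sum_type, Option.elim, Sum.elim_inl,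
      Sum.elim_inr]
    rw [← Finset.sum_add_distrib]
    have hG : ∑ i, s i * gain (E i) (x i) ω ≤ c * S.indicator (fun _ => (1 : ℝ)) ω := by
      by_cases hω : ω ∈ S
      · simpa [hω] using hc ω hω
      · rw [indicator_of_notMem hω, mul_zero]
        refine (Finset.sum_eq_zero fun i _ => ?_).le
        by_cases hi : s i = 0
        · simp [hi]
        · rw [gain_of_notMem, mul_zero]
          exact fun h => hω (hS ▸ ⟨i, hi, h⟩)
    simp only [gain_eq_sub] at hG
    refine le_trans (le_of_eq ?_) (sub_nonpos.2 hG)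
    rw [sub_eq_add_neg, add_comm]
    congr 1
    · exact Finset.sum_congr rfl fun i _ => by ring
    · ring
  simp only [a, A, Fintype.sum_option, Fintype.sum_sum_type, Option.elim, Sum.elim_inl,
    Sum.elim_inr] at this
  rw [← Finset.sum_add_distrib] at this
  have h : ∑ i, s i * (p ((E i).event ∩ (E i).given) - x i * p (E i).given) =
      ∑ i, (s i * p ((E i).event ∩ (E i).given) + -(s i * x i) * p (E i).given) :=
    Finset.sum_congr rfl fun i _ => by ring
  linarith

end IsFinAddProb

/-- An unconditional event, as a member of the domain of all unconditional events. -/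
def ofSet [Nonempty Ω] (A : Set Ω) : uncondEvents Ω := ⟨⟨A, univ, univ_nonempty⟩, rfl⟩

lemma dfCoherent_onUncond_iff [Nonempty Ω] {p : Set Ω → ℝ} :
    DFCoherent (onUncond p) ↔ IsFinAddProb p := by
  constructor
  · intro h
    refine ⟨fun A => h.wCoherent.nonneg (ofSet A),
      le_antisymm (h.wCoherent.le_one (ofSet univ))
        (h.wCoherent.one_le (ofSet univ) subset_rfl), fun A C hAC => ?_⟩
    have := h.eq_zero_of_const ![ofSet A, ofSet C, ofSet (A ∪ C)] ![1, 1, -1]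
      (c := p (A ∪ C) - p A - p C) ⟨0, by simp⟩ fun ω => by
        have hd : ω ∈ A → ω ∉ C := fun h => disjoint_left.1 hAC h
        by_cases hA : ω ∈ A <;> by_cases hC : ω ∈ C <;>
          simp [Fin.sum_univ_succ, gain, ofSet, onUncond, hA, hC] at hd ⊢ <;> ring
    linarith
  · intro hp m E s S hS hne
    refine nonneg_sSup_image fun c hc => ?_
    have hg : ∀ i, (E i).1.given = univ := fun i => (E i).2
    have hSu : S = univ := by
      obtain ⟨ω, hω⟩ := hne
      rw [hS] at hω ⊢
      obtain ⟨i, hi, -⟩ := hω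
      exact eq_univ_of_forall fun ω => ⟨i, hi, hg i ▸ mem_univ ω⟩
    have := hp.sum_le_of_gain_le (fun i => (E i).1) s (fun i => onUncond p (E i)) hS hc
    simpa [hSu, hg, hp.apply_univ, onUncond] using this

/-! ### Extension of probabilities to `A|B` -/

section Extension

variable {B : Set Ω} (hB : B.Nonempty)

lemma DFCoherent.condOn_mul {q : extDomain B → ℝ} (hq : DFCoherent q) (A : Set Ω) :
    q (condOn A hB) * restrictUncond hB q B = restrictUncond hB q (A ∩ B) := by
  have := hq.eq_zero_of_const ![condOn A hB, uncond (A ∩ B) hB, uncond B hB]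
    ![1, -1, q (condOn A hB)]
    (c := restrictUncond hB q (A ∩ B) - q (condOn A hB) * restrictUncond hB q B)
    ⟨0, by simp⟩ fun ω => by
      by_cases hA : ω ∈ A <;> by_cases hC : ω ∈ B <;>
        simp [Fin.sum_univ_succ, gain, condOn, uncond, restrictUncond, hA, hC] <;> ring
  linarith

/-- The conditional probability determined by `p` when `p B > 0`. -/
lemma IsFinAddProb.exists_extension_of_pos {p : Set Ω → ℝ} (hp : IsFinAddProb p)
    (hpB : 0 < p B) : ∃ q : extDomain B → ℝ, DFCoherent q ∧ restrictUncond hB q = p := by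
  refine ⟨fun E => p (E.1.event ∩ E.1.given) / p E.1.given, ?_, ?_⟩
  · intro m E s S hS hne
    refine nonneg_sSup_image fun c hc => ?_
    have hle : ∀ i, p B ≤ p (E i).1.given := fun i => hp.mono (by
      rcases (E i).2 with h | h <;> rw [h]
      exact subset_univ _)
    have hpS : 0 < p S := by
      obtain ⟨ω, hω⟩ := hne
      rw [hS] at hω
      obtain ⟨i, hi, -⟩ := hω
      refine (hpB.trans_le (hle i)).trans_le (hp.mono fun ω hω => ?_)
      rw [hS]
      exact ⟨i, hi, hω⟩
    have h := hp.sum_le_of_gain_le (fun i => (E i).1) s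
      (fun i => p ((E i).1.event ∩ (E i).1.given) / p (E i).1.given) hS hc
    rw [Finset.sum_eq_zero fun i _ => by
      rw [div_mul_cancel₀ _ (hpB.trans_le (hle i)).ne', sub_self, mul_zero]] at h
    exact nonneg_of_mul_nonneg_left h hpS
  · funext A
    simp [restrictUncond, uncond, hp.apply_univ]

/-- If `p B = 0`, then the conditional probability given `B` may be concentrated at any point
of `B`. -/
lemma IsFinAddProb.exists_extension_of_eq_zero {p : Set Ω → ℝ} (hp : IsFinAddProb p)
    (hpB : p B = 0) {b : Ω} (hb : b ∈ B) :
    ∃ q : extDomain B → ℝ, DFCoherent q ∧ restrictUncond hB q = p ∧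
      ∀ A, b ∉ A → q (condOn A hB) = 0 := by
  classical
  have hBu : B ≠ univ := fun h => by
    rw [h, hp.apply_univ] at hpB
    exact one_ne_zero hpB
  refine ⟨fun E => if E.1.given = univ then p E.1.event else
    E.1.event.indicator (fun _ => 1) b, ?_, ?_, ?_⟩
  · intro m E s S hS hne
    refine nonneg_sSup_image fun c hc => ?_
    by_cases hu : ∃ i, s i ≠ 0 ∧ (E i).1.given = univ
    · obtain ⟨i, hi, hiu⟩ := hu
      have hSu : S = univ := by
        rw [hS]
        exact eq_univ_of_forall fun ω => ⟨i, hi, hiu ▸ mem_univ ω⟩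
      have h := hp.sum_le_of_gain_le (fun i => (E i).1) s _ hS hc
      rw [hSu, hp.apply_univ, mul_one, Finset.sum_eq_zero] at h
      · exact h
      · intro j _
        dsimp only
        split_ifs with hj
        · simp [hj, hp.apply_univ]
        · have hjB : (E j).1.given = B := (E j).2.resolve_left hj
          have : p ((E j).1.event ∩ B) = 0 :=
            le_antisymm (hpB ▸ hp.mono inter_subset_right) (hp.nonneg _)
          simp [hjB, this, hpB]
    · push Not at hu
      have hbS : b ∈ S := by
        obtain ⟨ω, hω⟩ := hne
        rw [hS] at hω ⊢
        obtain ⟨i, hi, -⟩ := hω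
        exact ⟨i, hi, by rwa [(E i).2.resolve_left (hu i hi)]⟩
      refine le_trans (le_of_eq (Finset.sum_eq_zero fun i _ => ?_).symm) (hc b hbS)
      by_cases hi : s i = 0
      · simp [hi]
      · have hiB := (E i).2.resolve_left (hu i hi)
        simp [gain, hiB, hBu, hb]
  · funext A
    simp [restrictUncond, uncond]
  · intro A hA
    simp [condOn, hBu, hA]

lemma IsFinAddProb.exists_extension {p : Set Ω → ℝ} (hp : IsFinAddProb p) :
    ∃ q : extDomain B → ℝ, DFCoherent q ∧ restrictUncond hB q = p := by
  rcases (hp.nonneg B).eq_or_lt with h | h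
  · obtain ⟨q, hq, hqp, -⟩ := hp.exists_extension_of_eq_zero hB h.symm hB.some_mem
    exact ⟨q, hq, hqp⟩
  · exact hp.exists_extension_of_pos hB h

end Extension

/-! ### The core of a 2-monotone capacity -/

/-- A normalized monotone 2-monotone set function. -/
structure IsTwoMonotoneCapacity (P : Set Ω → ℝ) : Prop where
  apply_empty : P ∅ = 0
  apply_univ : P univ = 1
  mono : Monotone P
  twoMonotone : TwoMonotone P

/-- The pointwise larger set function that is modular with respect to `C`. -/
def modularize (P : Set Ω → ℝ) (C : Set Ω) : Set Ω → ℝ := fun A => P (A ∪ C) + P (A ∩ C) - P C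

namespace IsTwoMonotoneCapacity

variable {P : Set Ω → ℝ}

lemma modularize (hP : IsTwoMonotoneCapacity P) (C : Set Ω) :
    IsTwoMonotoneCapacity (modularize P C) := by
  refine ⟨by simp [ImpreciseProb.modularize, hP.apply_empty],
    by simp [ImpreciseProb.modularize, hP.apply_univ], fun A A' h => ?_, fun A A' => ?_⟩
  · have h₁ := hP.mono (union_subset_union_left C h)
    have h₂ := hP.mono (inter_subset_inter_left C h)
    simp only [ImpreciseProb.modularize]
    linarith
  · have h₁ := hP.twoMonotone (A ∪ C) (A' ∪ C)
    have h₂ := hP.twoMonotone (A ∩ C) (A' ∩ C)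
    rw [← union_union_distrib_right, ← inter_union_distrib_right] at h₁
    rw [← union_inter_distrib_right, ← inter_inter_distrib_right] at h₂
    simp only [ImpreciseProb.modularize]
    linarith

lemma le_modularize (hP : IsTwoMonotoneCapacity P) (C : Set Ω) :
    P ≤ ImpreciseProb.modularize P C := fun A => by
  have := hP.twoMonotone A C
  simp only [ImpreciseProb.modularize]
  linarith

lemma modularize_compl (hP : IsTwoMonotoneCapacity P) (C : Set Ω) :
    ImpreciseProb.modularize P C Cᶜ = 1 - P C := by
  simp [ImpreciseProb.modularize, hP.apply_empty, hP.apply_univ]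

lemma le_one (hP : IsTwoMonotoneCapacity P) (A : Set Ω) : P A ≤ 1 :=
  hP.apply_univ ▸ hP.mono (subset_univ A)

/-- The pointwise supremum of a chain of 2-monotone capacities is one. -/
lemma exists_upperBound_of_isChain {c : Set (Set Ω → ℝ)}
    (hc : ∀ Q ∈ c, IsTwoMonotoneCapacity Q) (hchain : IsChain (· ≤ ·) c) (hne : c.Nonempty) :
    ∃ U, IsTwoMonotoneCapacity U ∧ ∀ Q ∈ c, Q ≤ U := by
  have := hne.to_subtype
  let U : Set Ω → ℝ := fun A => ⨆ Q : c, Q.1 A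
  have hle : ∀ (Q : c) A, Q.1 A ≤ U A := fun Q A =>
    le_ciSup (f := fun Q : c => Q.1 A) ⟨1, by rintro _ ⟨Q, rfl⟩; exact (hc Q Q.2).le_one A⟩ Q
  refine ⟨U, ⟨?_, ?_, fun A C h => ciSup_le fun Q => ((hc Q Q.2).mono h).trans (hle Q C),
    fun A C => ?_⟩, fun Q hQ A => hle ⟨Q, hQ⟩ A⟩
  · simp [U, fun Q : c => (hc Q Q.2).apply_empty]
  · simp [U, fun Q : c => (hc Q Q.2).apply_univ]
  · have key : ∀ Q Q' : c, Q.1 A + Q'.1 C ≤ U (A ∪ C) + U (A ∩ C) := by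
      intro Q Q'
      rcases hchain.total Q.2 Q'.2 with h | h
      · linarith [h A, (hc Q' Q'.2).twoMonotone A C, hle Q' (A ∪ C), hle Q' (A ∩ C)]
      · linarith [h C, (hc Q Q.2).twoMonotone A C, hle Q (A ∪ C), hle Q (A ∩ C)]
    have h₁ : ∀ Q : c, U C ≤ U (A ∪ C) + U (A ∩ C) - Q.1 A := fun Q =>
      ciSup_le fun Q' => by linarith [key Q Q']
    have h₂ : U A ≤ U (A ∪ C) + U (A ∩ C) - U C := ciSup_le fun Q => by linarith [h₁ Q]
    linarith

/-- The core of a 2-monotone capacity is non-empty: a maximal 2-monotone capacity is modular. -/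
lemma exists_isFinAddProb_ge (hP : IsTwoMonotoneCapacity P) : ∃ p, IsFinAddProb p ∧ P ≤ p := by
  obtain ⟨p, hPp, hp, hmax⟩ := zorn_le_nonempty₀ {Q : Set Ω → ℝ | IsTwoMonotoneCapacity Q}
    (fun c hc hchain Q hQ => exists_upperBound_of_isChain hc hchain ⟨Q, hQ⟩) P hP
  have hp : IsTwoMonotoneCapacity p := hp
  refine ⟨p, ⟨fun A => hp.apply_empty ▸ hp.mono (empty_subset A), hp.apply_univ,
    fun A C hAC => ?_⟩, hPp⟩
  have h₁ := hmax (hp.modularize C) (hp.le_modularize C) A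
  have h₂ := hp.le_modularize C A
  simp only [ImpreciseProb.modularize, hAC.inter_eq, hp.apply_empty] at h₁ h₂
  linarith

/-- The core of a 2-monotone capacity has a member that attains it on a given chain of two
events. -/
lemma exists_isFinAddProb_eq (hP : IsTwoMonotoneCapacity P) {C D : Set Ω} (h : C ⊆ D) :
    ∃ p, IsFinAddProb p ∧ P ≤ p ∧ p C = P C ∧ p D = P D := by
  have hC := hP.modularize C
  obtain ⟨p, hp, hle⟩ := (hC.modularize D).exists_isFinAddProb_ge
  have hle' : ImpreciseProb.modularize P C ≤ p := (hC.le_modularize D).trans hle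
  have hPp : P ≤ p := (hP.le_modularize C).trans hle'
  refine ⟨p, hp, hPp, le_antisymm ?_ (hPp C), le_antisymm ?_ (hPp D)⟩
  · have := hle' Cᶜ
    rw [hP.modularize_compl, hp.compl] at this
    linarith
  · have := hle Dᶜ
    rw [hC.modularize_compl, hp.compl] at this
    simp only [ImpreciseProb.modularize, union_eq_self_of_subset_right h,
      inter_eq_self_of_subset_right h] at this
    linarith

end IsTwoMonotoneCapacity

lemma CoherentLower.isTwoMonotoneCapacity [Nonempty Ω] {P : Set Ω → ℝ} (hP : CoherentLower P)
    (h2 : TwoMonotone P) : IsTwoMonotoneCapacity P where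
  apply_empty := le_antisymm (WCoherent.le_zero hP (ofSet ∅) rfl) (WCoherent.nonneg hP (ofSet ∅))
  apply_univ := le_antisymm (WCoherent.le_one hP (ofSet univ))
    (WCoherent.one_le hP (ofSet univ) subset_rfl)
  mono A C h := WCoherent.le_of_subset hP (ofSet A) (ofSet C) rfl h
  twoMonotone := h2

/-! ### The natural and the regular extension -/

section NaturalExtension

variable {P : Set Ω → ℝ} {B : Set Ω} {hB : B.Nonempty}

/-- The probabilities on the extended domain that extend a member of the credal set. -/
def credalExt (P : Set Ω → ℝ) {B : Set Ω} (hB : B.Nonempty) : Set (extDomain B → ℝ) :=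
  {q | DFCoherent q ∧ restrictUncond hB q ∈ credal P}

lemma natExt_le {Q : extDomain B → ℝ} (hQ : Q ∈ coherentExtensions P hB) (E : extDomain B) :
    natExt P hB E ≤ Q E :=
  csInf_le ⟨0, by rintro _ ⟨Q, hQ, rfl⟩; exact hQ.1.nonneg E⟩ (mem_image_of_mem _ hQ)

lemma isLeast_natExt (hne : (coherentExtensions P hB).Nonempty) :
    IsLeast (coherentExtensions P hB) (natExt P hB) := by
  refine ⟨⟨WCoherent.sInf_image (fun Q hQ => hQ.1) hne, funext fun A => ?_⟩,
    fun Q hQ E => natExt_le hQ E⟩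
  have : (fun Q : extDomain B → ℝ => Q (uncond A hB)) '' coherentExtensions P hB = {P A} := by
    obtain ⟨Q, hQ⟩ := hne
    ext x
    constructor
    · rintro ⟨Q, hQ, rfl⟩
      exact congrFun hQ.2 A
    · rintro rfl
      exact ⟨Q, hQ, congrFun hQ.2 A⟩
  simp only [restrictUncond, natExt, this, csInf_singleton]

lemma credalExt_nonempty (hP : IsTwoMonotoneCapacity P) : (credalExt P hB).Nonempty := by
  have : Nonempty Ω := hB.to_type
  obtain ⟨p, hp, hle⟩ := hP.exists_isFinAddProb_ge
  obtain ⟨q, hq, rfl⟩ := hp.exists_extension hB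
  exact ⟨q, hq, dfCoherent_onUncond_iff.2 hp, hle⟩

lemma sInf_credalExt_mem_coherentExtensions (hP : IsTwoMonotoneCapacity P) :
    (fun E => sInf ((fun q : extDomain B → ℝ => q E) '' credalExt P hB)) ∈
      coherentExtensions P hB := by
  have : Nonempty Ω := hB.to_type
  have hne := credalExt_nonempty (hB := hB) hP
  refine ⟨WCoherent.sInf_image (fun q hq => hq.1.wCoherent) hne, funext fun A => ?_⟩
  refine le_antisymm ?_ (le_csInf (hne.image _) ?_)
  · obtain ⟨p, hp, hle, hpA, -⟩ := hP.exists_isFinAddProb_eq (subset_refl A)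
    obtain ⟨q, hq, rfl⟩ := hp.exists_extension hB
    rw [← hpA]
    exact csInf_le ⟨0, by rintro _ ⟨q, hq, rfl⟩; exact hq.1.wCoherent.nonneg _⟩
      (mem_image_of_mem _ ⟨hq, dfCoherent_onUncond_iff.2 hp, hle⟩)
  · rintro _ ⟨q, hq, rfl⟩
    exact hq.2.2 A

lemma natExt_le_of_mem_credalExt (hP : IsTwoMonotoneCapacity P) {q : extDomain B → ℝ}
    (hq : q ∈ credalExt P hB) (E : extDomain B) : natExt P hB E ≤ q E :=
  (natExt_le (sInf_credalExt_mem_coherentExtensions hP) E).trans <|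
    csInf_le ⟨0, by rintro _ ⟨q, hq, rfl⟩; exact hq.1.wCoherent.nonneg _⟩ (mem_image_of_mem _ hq)

/-- The lower bound that coherence imposes on `Q(A|B)`. -/
lemma le_condOn_mul {Q : extDomain B → ℝ} (hQ : Q ∈ coherentExtensions P hB) (A : Set Ω) :
    P (A ∩ B) ≤ Q (condOn A hB) * (P (A ∩ B) + conj P (Aᶜ ∩ B)) := by
  obtain ⟨hQ, rfl⟩ := hQ
  set μ := Q (condOn A hB) with hμ
  have h₀ : 0 ≤ μ := hQ.nonneg _
  have h₁ : μ ≤ 1 := hQ.le_one _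
  have := hQ.nonneg_of_le (condOn A hB) ![uncond (A ∩ B) hB, uncond (Aᶜ ∩ B)ᶜ hB]
    (s₀ := 1) (s := ![1 - μ, μ]) zero_le_one
    (by simp [Fin.forall_fin_two, h₀, h₁])
    (c := μ - (1 - μ) * Q (uncond (A ∩ B) hB) - μ * Q (uncond (Aᶜ ∩ B)ᶜ hB))
    ⟨_, Or.inl ⟨one_ne_zero, hB.some_mem⟩⟩ fun ω _ => le_of_eq (by
      simp only [Fin.sum_univ_two, Matrix.cons_val_zero, Matrix.cons_val_one, ← hμ]
      by_cases hA : ω ∈ A <;> by_cases hC : ω ∈ B <;>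
        simp [gain, condOn, uncond, hA, hC] <;> ring)
  simp only [conj, restrictUncond]
  linarith

/-- A member of the credal set that is lowest on `A ∩ B` and largest on `Aᶜ ∩ B`. -/
lemma exists_isFinAddProb_extreme (hP : IsTwoMonotoneCapacity P) (A B : Set Ω) :
    ∃ p, IsFinAddProb p ∧ P ≤ p ∧ p (A ∩ B) = P (A ∩ B) ∧ p (Aᶜ ∩ B) = conj P (Aᶜ ∩ B) := by
  obtain ⟨p, hp, hle, h₁, h₂⟩ := hP.exists_isFinAddProb_eq
    (C := A ∩ B) (D := (Aᶜ ∩ B)ᶜ) fun ω hω h => h.1 hω.1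
  refine ⟨p, hp, hle, h₁, ?_⟩
  rw [hp.compl] at h₂
  simp only [conj]
  linarith

lemma credalPos_nonempty_iff (hP : IsTwoMonotoneCapacity P) :
    (credalPos P B).Nonempty ↔ 0 < conj P B := by
  cases isEmpty_or_nonempty Ω
  · have h := hP.apply_univ
    rw [Subsingleton.elim (univ : Set Ω) ∅, hP.apply_empty] at h
    exact absurd h zero_ne_one
  constructor
  · rintro ⟨p, ⟨hp, hle⟩, hpos⟩
    have := hle Bᶜ
    rw [(dfCoherent_onUncond_iff.1 hp).compl] at this
    simp only [conj]
    linarith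
  · intro h
    obtain ⟨p, hp, hle, hpB, -⟩ := hP.exists_isFinAddProb_eq (subset_refl Bᶜ)
    refine ⟨p, ⟨dfCoherent_onUncond_iff.2 hp, hle⟩, ?_⟩
    rw [hp.compl] at hpB
    simp only [conj] at h
    linarith

lemma credalPosExt_nonempty (h : (credalPos P B).Nonempty) : (credalPosExt P hB).Nonempty := by
  have : Nonempty Ω := hB.to_type
  obtain ⟨p, hp, hpos⟩ := h
  obtain ⟨q, hq, rfl⟩ := (dfCoherent_onUncond_iff.1 hp.1).exists_extension_of_pos hB hpos
  exact ⟨q, hq, hp, hpos⟩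

lemma regExt_le (h : (credalPos P B).Nonempty) {q : extDomain B → ℝ}
    (hq : q ∈ credalPosExt P hB) (E : extDomain B) : regExt P hB E ≤ q E := by
  rw [regExt, if_pos h]
  exact csInf_le ⟨0, by rintro _ ⟨q, hq, rfl⟩; exact hq.1.wCoherent.nonneg _⟩
    (mem_image_of_mem _ hq)

lemma le_regExt (h : (credalPos P B).Nonempty) {E : extDomain B} {x : ℝ}
    (hx : ∀ q ∈ credalPosExt P hB, x ≤ q E) : x ≤ regExt P hB E := by
  rw [regExt, if_pos h]
  exact le_csInf ((credalPosExt_nonempty h).image _)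
    (by rintro _ ⟨q, hq, rfl⟩; exact hx q hq)

lemma natExt_le_regExt (hP : IsTwoMonotoneCapacity P) (h : (credalPos P B).Nonempty)
    (E : extDomain B) :
    natExt P hB E ≤ regExt P hB E :=
  le_regExt h fun _ hq => natExt_le_of_mem_credalExt hP ⟨hq.1, hq.2.1⟩ E

lemma regExt_le_one (h : (credalPos P B).Nonempty) (E : extDomain B) : regExt P hB E ≤ 1 := by
  obtain ⟨q, hq⟩ := credalPosExt_nonempty (hB := hB) h
  exact (regExt_le h hq E).trans (hq.1.wCoherent.le_one E)

/-- If `P (A ∩ B)` and the upper probability of `Aᶜ ∩ B` do not both vanish, then the natural and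
the regular extension are both given by the generalized Bayes rule. -/
lemma regExt_eq_natExt_of_pos (hP : IsTwoMonotoneCapacity P) {A : Set Ω}
    (hpos : 0 < P (A ∩ B) + conj P (Aᶜ ∩ B)) :
    regExt P hB (condOn A hB) = natExt P hB (condOn A hB) := by
  have : Nonempty Ω := hB.to_type
  obtain ⟨p, hp, hle, h₁, h₂⟩ := exists_isFinAddProb_extreme hP A B
  have hB' := hp.inter_add_compl_inter A B
  have hpB : 0 < p B := by linarith
  have hp' : p ∈ credalPos P B := ⟨⟨dfCoherent_onUncond_iff.2 hp, hle⟩, hpB⟩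
  refine le_antisymm ?_ (natExt_le_regExt hP ⟨p, hp'⟩ _)
  obtain ⟨q, hq, hqp⟩ := hp.exists_extension_of_pos hB hpB
  refine (regExt_le ⟨p, hp'⟩ ⟨hq, hqp ▸ hp'⟩ _).trans ?_
  have hmul := hq.condOn_mul hB A
  rw [hqp] at hmul
  have hnat := le_condOn_mul
    (isLeast_natExt ⟨_, sInf_credalExt_mem_coherentExtensions (hB := hB) hP⟩).1 A
  rw [← h₁, ← h₂, hB', ← hmul] at hnat
  exact le_of_mul_le_mul_right hnat hpB

lemma natExt_condOn_eq_zero (hP : IsTwoMonotoneCapacity P) {A : Set Ω}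
    (hPB : P B = 0) (hA : (Aᶜ ∩ B).Nonempty) :
    natExt P hB (condOn A hB) = 0 := by
  have : Nonempty Ω := hB.to_type
  obtain ⟨b, hbA, hbB⟩ := hA
  obtain ⟨p, hp, hle, hpB, -⟩ := hP.exists_isFinAddProb_eq (subset_refl B)
  obtain ⟨q, hq, rfl, hq0⟩ := hp.exists_extension_of_eq_zero hB (hpB.trans hPB) hbB
  refine le_antisymm ?_ ((isLeast_natExt
    ⟨_, sInf_credalExt_mem_coherentExtensions (hB := hB) hP⟩).1.1.nonneg _)
  rw [← hq0 A hbA]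
  exact natExt_le_of_mem_credalExt hP ⟨hq, dfCoherent_onUncond_iff.2 hp, hle⟩ _

lemma regExt_condOn_eq_one (hP : IsTwoMonotoneCapacity P) {A : Set Ω}
    (h : 0 < conj P B) (hA : conj P (Aᶜ ∩ B) = 0) :
    regExt P hB (condOn A hB) = 1 := by
  have : Nonempty Ω := hB.to_type
  have hne := (credalPos_nonempty_iff hP).2 h
  refine le_antisymm (regExt_le_one hne _) (le_regExt hne ?_)
  rintro q ⟨hq, ⟨hp, hle⟩, hpos⟩
  have hp := dfCoherent_onUncond_iff.1 hp
  have hle := hle (Aᶜ ∩ B)ᶜ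
  have hmul := hq.condOn_mul hB A
  have hB' := hp.inter_add_compl_inter A B
  rw [hp.compl] at hle
  simp only [conj] at hA
  refine le_of_mul_le_mul_right ?_ hpos
  linarith

end NaturalExtension

end ImpreciseProb

open ImpreciseProb in
theorem proposition14 {Ω : Type*} (P : Set Ω → ℝ) (hP : ImpreciseProb.CoherentLower P)
    (h2 : ImpreciseProb.TwoMonotone P) (B : Set Ω) (hB : B.Nonempty) :
    IsLeast (ImpreciseProb.coherentExtensions P hB) (ImpreciseProb.natExt P hB) ∧
    ∀ A : Set Ω,
      (ImpreciseProb.regExt P hB (ImpreciseProb.condOn A hB) ≠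
          ImpreciseProb.natExt P hB (ImpreciseProb.condOn A hB) ↔
        (0 = P B ∧ P B < ImpreciseProb.conj P B) ∧ Aᶜ ∩ B ≠ ∅ ∧
          ImpreciseProb.conj P (Aᶜ ∩ B) = 0) ∧
      ((0 = P B ∧ P B < ImpreciseProb.conj P B) ∧ Aᶜ ∩ B ≠ ∅ ∧
          ImpreciseProb.conj P (Aᶜ ∩ B) = 0 →
        ImpreciseProb.regExt P hB (ImpreciseProb.condOn A hB) = 1 ∧
          ImpreciseProb.natExt P hB (ImpreciseProb.condOn A hB) = 0) := by
  have : Nonempty Ω := hB.to_type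
  have hcap := CoherentLower.isTwoMonotoneCapacity hP h2
  have hleast := isLeast_natExt ⟨_, sInf_credalExt_mem_coherentExtensions (hB := hB) hcap⟩
  refine ⟨hleast, fun A => ?_⟩
  have hvalues : (0 = P B ∧ P B < conj P B) ∧ Aᶜ ∩ B ≠ ∅ ∧ conj P (Aᶜ ∩ B) = 0 →
      regExt P hB (condOn A hB) = 1 ∧ natExt P hB (condOn A hB) = 0 := by
    rintro ⟨⟨h0, hlt⟩, hne, hA⟩
    exact ⟨regExt_condOn_eq_one hcap (h0 ▸ hlt) hA,
      natExt_condOn_eq_zero hcap h0.symm (nonempty_iff_ne_empty.2 hne)⟩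
  refine ⟨⟨fun hRE => ?_, fun h => ?_⟩, hvalues⟩
  · obtain ⟨p, hp, hle, h₁, h₂⟩ := exists_isFinAddProb_extreme hcap A B
    have hsum := hp.inter_add_compl_inter A B
    have hnonpos : P (A ∩ B) + conj P (Aᶜ ∩ B) ≤ 0 :=
      not_lt.1 fun h => hRE (regExt_eq_natExt_of_pos hcap h)
    have hAB := hp.nonneg (A ∩ B)
    have hAcB := hp.nonneg (Aᶜ ∩ B)
    have hPB : 0 = P B := le_antisymm (hcap.apply_empty ▸ hcap.mono (empty_subset B))
      ((hle B).trans (by linarith))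
    have hpos : (credalPos P B).Nonempty := by
      by_contra h
      exact hRE (by rw [regExt, if_neg h])
    refine ⟨⟨hPB, hPB ▸ (credalPos_nonempty_iff hcap).1 hpos⟩, fun hempty => hRE ?_,
      by linarith⟩
    have hsub : B ⊆ A := fun ω hω => by
      by_contra hωA
      exact hempty.subset ⟨hωA, hω⟩
    exact le_antisymm ((regExt_le_one hpos _).trans
      (hleast.1.1.one_le (condOn A hB) hsub)) (natExt_le_regExt hcap hpos _)
  · obtain ⟨hR, hE⟩ := hvalues h
    rw [hR, hE]
    exact one_ne_zero
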